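/- Let $E$ and $F$ be finite-dimensional real Hilbert spaces (for instance $E=\mathbb{R}^n$, $F=\mathbb{R}^m$). For a function $\varphi:F\to\mathbb{R}\cup\{\pm\infty\}$ write $\operatorname{dom}\varphi=\{z:\varphi(z)<\infty\}$, $\varphi^*(y)=\sup_z\{\langle z,y\rangle-\varphi(z)\}$, $\operatorname{hzn}\varphi=\{v:\varphi(z+v)\le\varphi(z)\ \forall z\in\operatorname{dom}\varphi\}$, and let $\partial\varphi$ be the convex subdifferential. For a closed convex set $C$ let $\Pi_C$ and $\operatorname{dist}_C$ be its projection and distance function, and for $\gamma>0$ let $\operatorname{prox}_{\gamma\varphi}(w)$ be the minimizer of $\varphi+\frac1{2\gamma}\|\cdot-w\|^2$. **Problem.** Let $f:E\to\mathbb{R}$ be continuously differentiable and convex, let $g:F\to\mathbb{R}\cup\{+\infty\}$ be proper, lower semicontinuous and convex, and let $c:E\to F$ be continuously differentiable with $$c(\lambda x+(1-\lambda)x')-\lambda c(x)-(1-\lambda)c(x')\in\operatorname{hzn}g\qquad\text{for all }x,x'\in E,\ \lambda\in[0,1].$$ Assume that the problem (P) of minimizing $\Phi(x)=f(x)+g(c(x))$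 over $E$ is feasible and has a minimizer. Put $$\mathcal{L}(x,y)=f(x)+\inf_z\{g(z)+\langle y,c(x)-z\rangle\}=f(x)+\langle y,c(x)\rangle-g^*(y),\qquad \mathcal{M}(y)=\inf_x\mathcal{L}(x,y),$$ $$\mathcal{L}_\mu(x,y)=f(x)+\inf_z\Big\{g(z)+\langle y,c(x)-z\rangle+\tfrac1{2\mu}\|c(x)-z\|^2\Big\}\qquad(\mu>0).$$ A feasible point $\bar x$ is stationary if there is $\bar y\in F$ with $\nabla_x\mathcal{L}(\bar x,\bar y)=0$ and $c(\bar x)\in\partial g^*(\bar y)$. Suppose that (P) has a stationary minimizer $\bar x$, and let $$Y_{\mathrm{mul}}=\{y\in\partial g(c(\bar x)):\nabla_x\mathcal{L}(\bar x,y)=0\}$$ be its set of multipliers (it does not depend on the choice of $\bar x$). **Algorithm.** Let $Y_{\mathrm{sg}}\subseteq F$ be nonempty, convex and compact, let $\beta\in(0,1)$, $\mu_0>0$, $y^0\in F$, and let the sequences $(x^k),(z^k),(y^k),(\hat y^k),(\mu_k),(\varepsilon_k)$ satisfy, for all $k=0,1,2,\dots$, - $\hat y^k=\Pi_{Y_{\mathrm{sg}}}(y^k)$;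 - $\varepsilon_k\ge0$ and $\mathcal{L}_{\mu_k}(x^k,\hat y^k)\le\inf_x\mathcal{L}_{\mu_k}(x,\hat y^k)+\varepsilon_k$; - $z^k=\operatorname{prox}_{\mu_kg}(c(x^k)+\mu_k\hat y^k)$; - $y^{k+1}=\hat y^k+\mu_k^{-1}(c(x^k)-z^k)$; - $\mu_{k+1}=\beta_k\mu_k$ for some $\beta_k\in(0,\beta]\cup\{1\}$. Assume $\sum_{k=0}^\infty\sqrt{\varepsilon_k/\mu_k}<\infty$, and let $\mu\ge0$ be the limit of the nonincreasing sequence $(\mu_k)$. **Theorem 5.3.** The sequence $(y^k)$ is bounded, and the following hold. 1. If $\mu=0$, then every accumulation point of $(y^k)$ belongs to $Y_{\mathrm{mul}}$. 2. If $\mu>0$, then $(y^k)$ converges to a solution of the penalized dual problem $$\min_y\ -\mathcal{M}(y)+\tfrac{\mu}{2}\operatorname{dist}_{Y_{\mathrm{sg}}}^2(y).\tag{D$_\mu$}$$ 3. If $Y_{\mathrm{mul}}\cap Y_{\mathrm{sg}}\ne\emptyset$, then $(y^k)$ converges to a point of $Y_{\mathrm{mul}}\cap Y_{\mathrm{sg}}$.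 -/

import Mathlib

namespace ConvexComposite

section Convex

variable {F : Type*} [NormedAddCommGroup F] [InnerProductSpace ℝ F]

/-- A function with values in `[-∞, ∞]` is proper if its domain `{φ < ∞}` is nonempty and `φ` is
finite there. -/
def IsProper (φ : F → EReal) : Prop :=
  (∃ z, φ z < ⊤) ∧ ∀ z, φ z ≠ ⊥

/-- Convexity of an extended real-valued function: its epigraph in `F × ℝ` is convex. -/
def IsConvex (φ : F → EReal) : Prop :=
  Convex ℝ {p : F × ℝ | φ p.1 ≤ (p.2 : EReal)}

/-- The horizon `hzn φ = {v | ∀ z ∈ dom φ, φ (z + v) ≤ φ z}`. -/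
def hzn (φ : F → EReal) : Set F :=
  {v | ∀ z, φ z < ⊤ → φ (z + v) ≤ φ z}

/-- The conjugate `φ*(y) = sup_z {⟨z, y⟩ - φ z}`. -/
noncomputable def conj (φ : F → EReal) (y : F) : EReal :=
  ⨆ z, (((inner ℝ z y : ℝ) : EReal) - φ z)

/-- The subdifferential of `φ` at `zbar` (empty where `φ zbar` is not finite). -/
def subdiff (φ : F → EReal) (zbar : F) : Set F :=
  {y | φ zbar ≠ ⊤ ∧ φ zbar ≠ ⊥ ∧
    ∀ z, φ z < ⊤ → φ zbar + ((inner ℝ y (z - zbar) : ℝ) : EReal) ≤ φ z}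

/-- `z` is the proximal point `prox_{γ φ}(w)`, i.e. a minimizer of `φ + (1 / (2γ)) ‖· - w‖²`
(which exists and is unique for proper, lsc, convex `φ` and `γ > 0`). -/
def IsProx (γ : ℝ) (φ : F → EReal) (w z : F) : Prop :=
  ∀ z', φ z + ((1 / (2 * γ) * ‖z - w‖ ^ 2 : ℝ) : EReal) ≤
    φ z' + ((1 / (2 * γ) * ‖z' - w‖ ^ 2 : ℝ) : EReal)

/-- `p` is the projection of `w` onto the (nonempty, closed, convex) set `C`. -/
def IsProj (C : Set F) (w p : F) : Prop :=
  p ∈ C ∧ ‖p - w‖ = Metric.infDist w C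

end Convex

variable {E F : Type*} [NormedAddCommGroup E] [InnerProductSpace ℝ E]
  [NormedAddCommGroup F] [InnerProductSpace ℝ F]

/-- The objective `Φ = f + g ∘ c` of the composite problem `(P)`. -/
noncomputable def objective (f : E → ℝ) (g : F → EReal) (c : E → F) (x : E) : EReal :=
  (f x : EReal) + g (c x)

/-- `x` is a (feasible) global minimizer of `(P)`. -/
def IsMinimizer (f : E → ℝ) (g : F → EReal) (c : E → F) (x : E) : Prop :=
  objective f g c x < ⊤ ∧ ∀ x', objective f g c x ≤ objective f g c x'

/-- The standing assumption of fully convex composite optimization. -/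
structure FullyConvex (f : E → ℝ) (g : F → EReal) (c : E → F) : Prop where
  f_contDiff : ContDiff ℝ 1 f
  f_convex : ConvexOn ℝ Set.univ f
  g_proper : IsProper g
  g_lsc : LowerSemicontinuous g
  g_convex : IsConvex g
  c_contDiff : ContDiff ℝ 1 c
  c_convex : ∀ x x' : E, ∀ t ∈ Set.Icc (0 : ℝ) 1,
    c (t • x + (1 - t) • x') - t • c x - (1 - t) • c x' ∈ hzn g
  exists_minimizer : ∃ x, IsMinimizer f g c x

/-- The generalized Lagrangian `L(x, y) = f x + inf_z {g z + ⟨y, c x - z⟩}`. -/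
noncomputable def lagrangian (f : E → ℝ) (g : F → EReal) (c : E → F) (x : E) (y : F) : EReal :=
  (f x : EReal) + ⨅ z, (g z + ((inner ℝ y (c x - z) : ℝ) : EReal))

/-- The augmented Lagrangian
`L_μ(x, y) = f x + inf_z {g z + ⟨y, c x - z⟩ + (1 / (2μ)) ‖c x - z‖²}`. -/
noncomputable def augLagrangian (f : E → ℝ) (g : F → EReal) (c : E → F) (μ : ℝ) (x : E) (y : F) :
    EReal :=
  (f x : EReal) +
    ⨅ z, (g z + ((inner ℝ y (c x - z) + 1 / (2 * μ) * ‖c x - z‖ ^ 2 : ℝ) : EReal))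

/-- The dual objective `M(y) = inf_x L(x, y)`. -/
noncomputable def dualObjective (f : E → ℝ) (g : F → EReal) (c : E → F) (y : F) : EReal :=
  ⨅ x, lagrangian f g c x y

/-- `∇_x L(x, y) = 0`. As a function of `x` the Lagrangian is `f + ⟨y, c⟩` up to the additive
term `-g*(y)`, so the condition says that the derivative of `f + ⟨y, c⟩` at `x` is zero. -/
def LagrangianGradZero (f : E → ℝ) (c : E → F) (x : E) (y : F) : Prop :=
  HasFDerivAt (fun x' => f x' + inner ℝ y (c x')) (0 : E →L[ℝ] ℝ) x

/-- Stationarity of a feasible point: for some `y`, `∇_x L(x, y) = 0` and `c x ∈ ∂g*(y)`. -/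
def IsStationary (f : E → ℝ) (g : F → EReal) (c : E → F) (x : E) : Prop :=
  g (c x) < ⊤ ∧ ∃ y, LagrangianGradZero f c x y ∧ c x ∈ subdiff (conj g) y

/-- The set of multipliers associated with `x`, `{y ∈ ∂g(c x) | ∇_x L(x, y) = 0}`. -/
def multipliers (f : E → ℝ) (g : F → EReal) (c : E → F) (x : E) : Set F :=
  {y | y ∈ subdiff g (c x) ∧ LagrangianGradZero f c x y}

/-- The objective `-M + (μ / 2) dist_{Ysg}²` of the penalized dual problem `(D_μ)`. -/
noncomputable def penalizedDual (f : E → ℝ) (g : F → EReal) (c : E → F) (Ysg : Set F) (μ : ℝ)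
    (y : F) : EReal :=
  -dualObjective f g c y + ((μ / 2 * Metric.infDist y Ysg ^ 2 : ℝ) : EReal)

/-- `y` solves `(D_μ)`: it has finite objective value and is a global minimizer. -/
def SolvesPenalizedDual (f : E → ℝ) (g : F → EReal) (c : E → F) (Ysg : Set F) (μ : ℝ) (y : F) :
    Prop :=
  penalizedDual f g c Ysg μ y < ⊤ ∧
    ∀ y', penalizedDual f g c Ysg μ y ≤ penalizedDual f g c Ysg μ y'

/-- The sequences `x^k, z^k, y^k, ŷ^k` together with the penalty parameters `μ_k` and the
tolerances `ε_k` are generated by the augmented Lagrangian method with (rigid) safeguarding set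
`Ysg` and parameter `β ∈ (0, 1)`; the free initial data are `y 0` and `μ 0`. -/
structure IsSafeguardedALM (f : E → ℝ) (g : F → EReal) (c : E → F) (Ysg : Set F) (β : ℝ)
    (x : ℕ → E) (z y yhat : ℕ → F) (μ ε : ℕ → ℝ) : Prop where
  Ysg_nonempty : Ysg.Nonempty
  Ysg_convex : Convex ℝ Ysg
  Ysg_compact : IsCompact Ysg
  β_mem : β ∈ Set.Ioo (0 : ℝ) 1
  μ_zero_pos : 0 < μ 0
  yhat_proj : ∀ k, IsProj Ysg (y k) (yhat k)
  ε_nonneg : ∀ k, 0 ≤ ε k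
  subproblem : ∀ k, augLagrangian f g c (μ k) (x k) (yhat k) ≤
    (⨅ x', augLagrangian f g c (μ k) x' (yhat k)) + (ε k : EReal)
  z_prox : ∀ k, IsProx (μ k) g (c (x k) + μ k • yhat k) (z k)
  y_update : ∀ k, y (k + 1) = yhat k + (μ k)⁻¹ • (c (x k) - z k)
  μ_update : ∀ k, ∃ βk ∈ Set.Ioc 0 β ∪ {1}, μ (k + 1) = βk * μ k

end ConvexComposite

namespace ConvexComposite

open Filter Topology

/-! ### Projections onto compact convex sets -/

section Projection

/-! The method is an inexact proximal point method on the dual, with a projection before each step.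
Let `A = valueSet f g c` collect the pairs `(u, r)` with `f x + g (c x - u) ≤ r` for some `x`. The
horizon condition on `c` makes `A` convex, and `dualHyp A` is the hypograph of the dual objective `M
η = inf {r + ⟨η, u⟩}`.

One step approximately minimizes `r + ⟨w, u⟩ + ‖u‖² / (2μ)` over `A` at `w = yhat k` and sets `y (k
+ 1) = w + u / μ`. An exact infimum would give the maximizer of `M - (μ / 2) ‖· - w‖²`; quadratic
growth bounds the error by `√2 √(ε / μ)` (`exists_isDualProx`, `exists_mem_valueSet_of_subproblem`).
So `y (k + 1)` is prox ∘ projection applied to `y k`, up to a summable error.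

The multipliers are exactly the maximizers of `M` (`mem_multipliers_iff`), hence fixed points of
every proximal map. Boundedness follows since the maps are nonexpansive and `yhat` stays in a
compact set. If `μ → 0`, comparing values with a multiplier shows that `M (y k)` is asymptotically
at least maximal. If the limit is positive, `μ` is eventually constant, and prox ∘ projection is a
fixed averaged map whose fixed points solve the penalized dual; quasi-Fejér monotonicity gives
convergence. A multiplier in `Ysg` is fixed by both maps for all `μ`, so the Fejér argument also
works as `μ → 0`. -/

theorem exists_isProj {F : Type*} [NormedAddCommGroup F] {C : Set F} (hne : C.Nonempty) (hC : IsCompact C) (w : F) :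
    ∃ p, IsProj C w p := by
  obtain ⟨p, hp, h⟩ := hC.exists_infDist_eq_dist hne w
  exact ⟨p, hp, by rw [h, dist_comm, dist_eq_norm]⟩

variable {F : Type*} [NormedAddCommGroup F] [InnerProductSpace ℝ F]

theorem IsProj.inner_le_zero {C : Set F} (hC : Convex ℝ C) {w p : F} (h : IsProj C w p)
    {q : F} (hq : q ∈ C) : inner ℝ (w - p) (q - p) ≤ 0 := by
  refine (norm_eq_iInf_iff_real_inner_le_zero hC h.1).1 ?_ q hq
  rw [norm_sub_rev, h.2, Metric.infDist_eq_iInf]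
  simp only [dist_eq_norm]

/-- The two obtuse-angle inequalities, each tested at the other projection, make the cross term
nonnegative. -/
theorem IsProj.firmly_nonexpansive {C : Set F} (hC : Convex ℝ C) {a b p q : F}
    (ha : IsProj C a p) (hb : IsProj C b q) :
    ‖p - q‖ ^ 2 + ‖(a - p) - (b - q)‖ ^ 2 ≤ ‖a - b‖ ^ 2 := by
  have h1 := ha.inner_le_zero hC hb.1
  have h2 := hb.inner_le_zero hC ha.1
  have e : a - b = (p - q) + ((a - p) - (b - q)) := by abel
  have h3 : inner ℝ (p - q) ((a - p) - (b - q)) =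
      -inner ℝ (a - p) (q - p) - inner ℝ (b - q) (p - q) := by
    rw [inner_sub_right, real_inner_comm, real_inner_comm (b - q), ← neg_sub q p, inner_neg_right,
      inner_neg_right]
  rw [e, norm_add_sq_real, h3]
  linarith

/-- A lower bound for the squared distance: linearization at `y`. -/
theorem IsProj.norm_sq_sub_le {C : Set F} (hC : Convex ℝ C) {y w η : F} (h : IsProj C y w)
    (hne : C.Nonempty) (hcpt : IsCompact C) :
    ‖η - w‖ ^ 2 - ‖η - y‖ ^ 2 ≤ Metric.infDist η C ^ 2 := by
  obtain ⟨q, hq⟩ := exists_isProj hne hcpt η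
  have h1 := h.inner_le_zero hC hq.1
  rw [← hq.2]
  have e1 : η - w = (η - q) + (q - w) := by abel
  have e2 : η - y = (η - q) + (q - w) - (y - w) := by abel
  have e3 : q - η = -(η - q) := by abel
  rw [e2, e1, e3, norm_neg, norm_sub_sq_real _ (y - w), inner_add_left,
    real_inner_comm (y - w) (q - w)]
  have := sq_nonneg ‖(η - q) - (y - w)‖
  rw [norm_sub_sq_real] at this
  linarith

end Projection

/-! ### Quasi-Fejér sequences with summable errors -/

section Fejer

theorem exists_tendsto_of_le_add {a e : ℕ → ℝ} (ha : ∀ k, 0 ≤ a k) (he : ∀ k, 0 ≤ e k)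
    (hs : Summable e) (h : ∀ k, a (k + 1) ≤ a k + e k) : ∃ l, Tendsto a atTop (𝓝 l) := by
  have hanti : Antitone fun k => a k - ∑ i ∈ Finset.range k, e i := by
    refine antitone_nat_of_succ_le fun k => ?_
    rw [Finset.sum_range_succ]
    linarith [h k]
  have hbdd : BddBelow (Set.range fun k => a k - ∑ i ∈ Finset.range k, e i) := by
    refine ⟨-∑' i, e i, ?_⟩
    rintro _ ⟨k, rfl⟩
    have := hs.sum_le_tsum (Finset.range k) fun i _ => he i
    have := ha k
    simp only
    linarith
  refine ⟨_, ((tendsto_atTop_ciInf hanti hbdd).add hs.hasSum.tendsto_sum_nat).congr fun k => ?_⟩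
  ring

variable {F : Type*} [NormedAddCommGroup F] [ProperSpace F]

/-- The distance to each point of `S` converges; taken to a cluster point, which lies in `S`, its
limit must be zero. -/
theorem exists_tendsto_of_quasiFejer {y : ℕ → F} {e : ℕ → ℝ} {S : Set F} (hS : S.Nonempty)
    (he : ∀ k, 0 ≤ e k) (hs : Summable e)
    (h : ∀ q ∈ S, ∀ k, ‖y (k + 1) - q‖ ≤ ‖y k - q‖ + e k)
    (hc : ∀ a, MapClusterPt a atTop y → a ∈ S) : ∃ a ∈ S, Tendsto y atTop (𝓝 a) := by
  have hlim : ∀ q ∈ S, ∃ l, Tendsto (fun k => ‖y k - q‖) atTop (𝓝 l) := fun q hq =>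
    exists_tendsto_of_le_add (fun _ => norm_nonneg _) he hs (h q hq)
  obtain ⟨q, hq⟩ := hS
  obtain ⟨l, hl⟩ := hlim q hq
  obtain ⟨R, hR⟩ := hl.bddAbove_range
  obtain ⟨a, -, φ, hφ, ha⟩ := tendsto_subseq_of_bounded (x := y)
    (Metric.isBounded_closedBall (x := q) (r := R)) fun k => by
      rw [mem_closedBall_iff_norm]
      exact hR ⟨k, rfl⟩
  have haS : a ∈ S := hc a (MapClusterPt.of_comp hφ.tendsto_atTop ha.mapClusterPt)
  refine ⟨a, haS, ?_⟩
  obtain ⟨l', hl'⟩ := hlim a haS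
  have h0 : Tendsto (fun k => ‖y (φ k) - a‖) atTop (𝓝 0) :=
    tendsto_iff_norm_sub_tendsto_zero.1 ha
  rw [tendsto_nhds_unique (hl'.comp hφ.tendsto_atTop) h0] at hl'
  exact tendsto_iff_norm_sub_tendsto_zero.2 hl'

end Fejer

/-! ### Proximal points of the dual function through regularized primal values -/

section DualProx

variable {F : Type*} [NormedAddCommGroup F] [InnerProductSpace ℝ F]

/-- The hypograph of the concave function `η ↦ inf {r + ⟨η, u⟩ | (u, r) ∈ A}`. -/
def dualHyp (A : Set (F × ℝ)) : Set (F × ℝ) :=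
  {q | ∀ p ∈ A, q.2 ≤ p.2 + inner ℝ q.1 p.1}

/-- `p` maximizes `M - (μ / 2) ‖· - w‖²`, where `M` is the concave function with hypograph
`dualHyp A`; the quadratic growth at the maximizer is part of the definition. -/
def IsDualProx (A : Set (F × ℝ)) (μ : ℝ) (w p : F) : Prop :=
  ∃ s, (p, s) ∈ dualHyp A ∧ ∀ q ∈ dualHyp A,
    q.2 - μ / 2 * ‖q.1 - w‖ ^ 2 + μ / 2 * ‖q.1 - p‖ ^ 2 ≤ s - μ / 2 * ‖p - w‖ ^ 2

theorem isClosed_dualHyp (A : Set (F × ℝ)) : IsClosed (dualHyp A) := by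
  have : dualHyp A = ⋂ p ∈ A, {q : F × ℝ | q.2 ≤ p.2 + inner ℝ q.1 p.1} := by
    ext q
    simp [dualHyp]
  rw [this]
  exact isClosed_biInter fun p _ => isClosed_le (by fun_prop) (by fun_prop)

/-- Test each growth inequality at the other proximal point and add: the values of `M` cancel. -/
theorem IsDualProx.firmly_nonexpansive {A : Set (F × ℝ)} {μ : ℝ} (hμ : 0 < μ) {a b p q : F}
    (ha : IsDualProx A μ a p) (hb : IsDualProx A μ b q) :
    ‖p - q‖ ^ 2 + ‖(a - p) - (b - q)‖ ^ 2 ≤ ‖a - b‖ ^ 2 := by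
  obtain ⟨s, hs, ha⟩ := ha
  obtain ⟨t, ht, hb⟩ := hb
  have h1 := ha _ ht
  have h2 := hb _ hs
  simp only at h1 h2
  have h3 : ‖q - a‖ ^ 2 + ‖p - b‖ ^ 2 - ‖p - a‖ ^ 2 - ‖q - b‖ ^ 2 - 2 * ‖p - q‖ ^ 2 ≥ 0 := by
    rw [norm_sub_rev q p] at h1
    nlinarith
  have e1 : q - a = -(p - q) - (a - p) := by abel
  have e2 : p - b = (p - q) - (b - q) := by abel
  have e3 : a - b = (p - q) + ((a - p) - (b - q)) := by abel
  rw [e1, e2, norm_sub_rev p a, norm_sub_rev q b, norm_sub_sq_real (-(p - q)),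
    norm_sub_sq_real (p - q) (b - q), norm_neg, inner_neg_left] at h3
  rw [e3, norm_add_sq_real, inner_sub_right]
  linarith

theorem IsDualProx.nonexpansive {A : Set (F × ℝ)} {μ : ℝ} (hμ : 0 < μ) {a b p q : F}
    (ha : IsDualProx A μ a p) (hb : IsDualProx A μ b q) : ‖p - q‖ ≤ ‖a - b‖ := by
  have := ha.firmly_nonexpansive hμ hb
  refine (sq_le_sq₀ (norm_nonneg _) (norm_nonneg _)).1 ?_
  linarith [sq_nonneg ‖(a - p) - (b - q)‖]

/-- Since `(0, r₀) ∈ A` caps the hypograph at height `r₀`, such an `a` maximizes `M`, and the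
penalty vanishes there. -/
theorem isDualProx_self {A : Set (F × ℝ)} {r₀ : ℝ} (h0 : (0, r₀) ∈ A) {a : F}
    (ha : (a, r₀) ∈ dualHyp A) {μ : ℝ} : IsDualProx A μ a a := by
  refine ⟨r₀, ha, fun q hq => ?_⟩
  have := hq _ h0
  simp at this ⊢
  exact this

/-- The regularized primal value over `A`. -/
noncomputable def regValue (μ : ℝ) (w : F) (q : F × ℝ) : ℝ :=
  q.2 + inner ℝ w q.1 + 1 / (2 * μ) * ‖q.1‖ ^ 2

theorem regValue_combo (μ : ℝ) (w : F) (p q : F × ℝ) (t : ℝ) :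
    regValue μ w ((1 - t) • p + t • q) = (1 - t) * regValue μ w p + t * regValue μ w q
      - t * (1 - t) / (2 * μ) * ‖q.1 - p.1‖ ^ 2 := by
  simp only [regValue, Prod.fst_add, Prod.snd_add, Prod.smul_fst, Prod.smul_snd, inner_add_right,
    inner_smul_right, norm_add_sq_real, norm_sub_sq_real, inner_smul_left, norm_smul, mul_pow,
    Real.norm_eq_abs, sq_abs, smul_eq_mul, real_inner_comm p.1 q.1]
  simp
  ring

theorem le_regValue {A : Set (F × ℝ)} {μ : ℝ} (hμ : 0 < μ) {w : F} {q p : F × ℝ}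
    (hq : q ∈ dualHyp A) (hp : p ∈ A) : q.2 - μ / 2 * ‖q.1 - w‖ ^ 2 ≤ regValue μ w p := by
  have h1 := hq p hp
  have h2 := sq_nonneg ‖μ • (q.1 - w) - p.1‖
  rw [norm_sub_sq_real, norm_smul, inner_smul_left, inner_sub_left, mul_pow, Real.norm_eq_abs,
    sq_abs] at h2
  simp only [conj_trivial] at h2
  have h3 : 0 ≤ 1 / (2 * μ) * (μ ^ 2 * ‖q.1 - w‖ ^ 2 -
      2 * (μ * (inner ℝ q.1 p.1 - inner ℝ w p.1)) + ‖p.1‖ ^ 2) := by positivity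
  have h4 : 1 / (2 * μ) * (μ ^ 2 * ‖q.1 - w‖ ^ 2 -
      2 * (μ * (inner ℝ q.1 p.1 - inner ℝ w p.1)) + ‖p.1‖ ^ 2) =
      μ / 2 * ‖q.1 - w‖ ^ 2 - (inner ℝ q.1 p.1 - inner ℝ w p.1) + 1 / (2 * μ) * ‖p.1‖ ^ 2 := by
    field_simp
  rw [h4] at h3
  unfold regValue
  linarith

variable [FiniteDimensional ℝ F]

/-- The regularized value has an infimum `V` over `A`, and the first components of a minimizing
sequence converge to a point `ubar` around which the value grows quadratically. -/
theorem exists_regValue_growth {A : Set (F × ℝ)} (hA : Convex ℝ A) (hne : A.Nonempty)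
    (hB : (dualHyp A).Nonempty) {μ : ℝ} (hμ : 0 < μ) (w : F) :
    ∃ (V : ℝ) (ubar : F) (p : ℕ → F × ℝ), (∀ n, p n ∈ A) ∧
      Tendsto (fun n => regValue μ w (p n)) atTop (𝓝 V) ∧
      Tendsto (fun n => (p n).1) atTop (𝓝 ubar) ∧
      (∀ q ∈ A, V + 1 / (2 * μ) * ‖q.1 - ubar‖ ^ 2 ≤ regValue μ w q) ∧
      ∀ l, (∀ q ∈ A, l ≤ regValue μ w q) → l ≤ V := by
  obtain ⟨b, hb⟩ := hB
  have hbdd : BddBelow (regValue μ w '' A) :=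
    ⟨_, by rintro _ ⟨p, hp, rfl⟩; exact le_regValue hμ hb hp⟩
  set V := sInf (regValue μ w '' A) with hV
  have hVle : ∀ q ∈ A, V ≤ regValue μ w q := fun q hq => csInf_le hbdd ⟨q, hq, rfl⟩
  have hex : ∀ n : ℕ, ∃ p ∈ A, regValue μ w p < V + 1 / ((n : ℝ) + 1) := fun n => by
    obtain ⟨_, ⟨p, hp, rfl⟩, h⟩ := exists_lt_of_csInf_lt (hne.image (regValue μ w))
      (lt_add_of_pos_right V (Nat.one_div_pos_of_nat (α := ℝ) (n := n)))
    exact ⟨p, hp, h⟩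
  choose p hpA hp using hex
  have hpV : Tendsto (fun n => regValue μ w (p n)) atTop (𝓝 V) := by
    refine tendsto_of_tendsto_of_tendsto_of_le_of_le tendsto_const_nhds ?_
      (fun n => hVle _ (hpA n)) (fun n => (hp n).le)
    simpa using tendsto_one_div_add_atTop_nhds_zero_nat.const_add V
  have hcombo : ∀ t ∈ Set.Icc (0 : ℝ) 1, ∀ p ∈ A, ∀ q ∈ A,
      V ≤ (1 - t) * regValue μ w p + t * regValue μ w q
        - t * (1 - t) / (2 * μ) * ‖q.1 - p.1‖ ^ 2 := fun t ht p hp q hq => by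
    rw [← regValue_combo]
    exact hVle _ (hA hp hq (by linarith [ht.2]) ht.1 (by ring))
  -- At the midpoint of `p 0` and `p n`, strong convexity contributes `‖·‖² / (8μ)`, while both
  -- values exceed `V` by at most `1`.
  have hb : ∀ n, (p n).1 ∈ Metric.closedBall (p 0).1 (Real.sqrt (8 * μ)) := fun n => by
    rw [mem_closedBall_iff_norm]
    apply Real.le_sqrt_of_sq_le
    have h1 := hcombo (1 / 2) (by norm_num) _ (hpA 0) _ (hpA n)
    have h2 := hp 0
    have h3 := hp n
    have h4 : 1 / ((n : ℝ) + 1) ≤ 1 := by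
      rw [div_le_one (by positivity)]
      linarith [n.cast_nonneg (α := ℝ)]
    have h5 : 1 / 2 * (1 - 1 / 2) / (2 * μ) * ‖(p n).1 - (p 0).1‖ ^ 2 ≤ 1 := by
      norm_num at h1 h2 ⊢
      linarith
    have h6 : 1 / 2 * (1 - 1 / 2) / (2 * μ) * ‖(p n).1 - (p 0).1‖ ^ 2 =
        ‖(p n).1 - (p 0).1‖ ^ 2 / (8 * μ) := by
      field_simp
      ring
    rwa [h6, div_le_one (by positivity)] at h5
  obtain ⟨u, -, φ, hφ, hu⟩ := tendsto_subseq_of_bounded Metric.isBounded_closedBall hb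
  have hpV' := hpV.comp hφ.tendsto_atTop
  refine ⟨V, u, p ∘ φ, fun n => hpA _, hpV', hu, fun q hq => ?_, fun l hl => ?_⟩
  -- For fixed `t`, pass to the limit along the minimizing sequence and divide by `t`; then let `t →
  -- 0` to get the full constant.
  · have h1 : ∀ t ∈ Set.Ioo (0 : ℝ) 1,
        V + (1 - t) / (2 * μ) * ‖q.1 - u‖ ^ 2 ≤ regValue μ w q := fun t ht => by
      have h2 : V ≤ (1 - t) * V + t * regValue μ w q
          - t * (1 - t) / (2 * μ) * ‖q.1 - u‖ ^ 2 := by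
        refine ge_of_tendsto' (((hpV'.const_mul (1 - t)).add_const _).sub
          (((hu.const_sub q.1).norm.pow 2).const_mul _)) fun n => ?_
        exact hcombo t ⟨ht.1.le, ht.2.le⟩ _ (hpA _) q hq
      have h3 : t * (V + (1 - t) / (2 * μ) * ‖q.1 - u‖ ^ 2) ≤ t * regValue μ w q := by
        have : t * (1 - t) / (2 * μ) * ‖q.1 - u‖ ^ 2 =
          t * ((1 - t) / (2 * μ) * ‖q.1 - u‖ ^ 2) := by ring
        linarith
      exact le_of_mul_le_mul_left h3 ht.1
    have h4 : Tendsto (fun t : ℝ => V + (1 - t) / (2 * μ) * ‖q.1 - u‖ ^ 2) (𝓝[>] 0)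
        (𝓝 (V + (1 - 0) / (2 * μ) * ‖q.1 - u‖ ^ 2)) := by
      refine Tendsto.mono_left ?_ nhdsWithin_le_nhds
      exact Continuous.tendsto (by fun_prop) 0
    rw [sub_zero] at h4
    exact le_of_tendsto h4 (Filter.eventually_of_mem (Ioo_mem_nhdsGT one_pos) h1)
  · exact ge_of_tendsto' hpV fun n => hl _ (hpA n)

/-- The proximal point is `w + u / μ`, with `u` the limit of a minimizing sequence: growth around
`u` puts it in the hypograph, and the limit of the dual bounds gives maximality. An `ε`-minimizer
lies within `√(2με)` of `u`, and division by `μ` gives the error. -/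
theorem exists_isDualProx {A : Set (F × ℝ)} (hA : Convex ℝ A) (hne : A.Nonempty)
    (hB : (dualHyp A).Nonempty) {μ : ℝ} (hμ : 0 < μ) (w : F) :
    ∃ p, IsDualProx A μ w p ∧ ∀ q ∈ A, ∀ ε, (∀ q' ∈ A, regValue μ w q ≤ regValue μ w q' + ε) →
      ‖w + μ⁻¹ • q.1 - p‖ ≤ Real.sqrt 2 * Real.sqrt (ε / μ) := by
  obtain ⟨V, u, P, hPA, hPV, hPu, hgrow, hglb⟩ := exists_regValue_growth hA hne hB hμ w
  have hwu : ‖w + μ⁻¹ • u - w‖ ^ 2 = μ⁻¹ ^ 2 * ‖u‖ ^ 2 := by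
    rw [add_sub_cancel_left, norm_smul, mul_pow, Real.norm_eq_abs, sq_abs]
  refine ⟨w + μ⁻¹ • u, ⟨V + 1 / (2 * μ) * ‖u‖ ^ 2, fun q hq => ?_, fun q hq => ?_⟩,
    fun q hq ε hε => ?_⟩
  · have h1 := hgrow q hq
    rw [regValue, norm_sub_sq_real] at h1
    have h2 : 1 / (2 * μ) * (‖q.1‖ ^ 2 - 2 * inner ℝ q.1 u + ‖u‖ ^ 2) =
        1 / (2 * μ) * ‖q.1‖ ^ 2 - μ⁻¹ * inner ℝ q.1 u + 1 / (2 * μ) * ‖u‖ ^ 2 := by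
      field_simp
    rw [h2] at h1
    simp only [inner_add_left, inner_smul_left, conj_trivial, real_inner_comm q.1 u]
    linarith
  · have h1 : q.2 - inner ℝ q.1 u + inner ℝ w u + 1 / (2 * μ) * ‖u‖ ^ 2 ≤ V := by
      refine le_of_tendsto_of_tendsto' (b := atTop)
        (f := fun n => q.2 - inner ℝ q.1 (P n).1 + inner ℝ w (P n).1
          + 1 / (2 * μ) * ‖(P n).1‖ ^ 2) ?_ hPV fun n => ?_
      · exact (((tendsto_const_nhds.inner hPu).const_sub _).add
          (tendsto_const_nhds.inner hPu)).add ((hPu.norm.pow 2).const_mul _)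
      · have := hq _ (hPA n)
        simp only [regValue]
        linarith
    have e : q.1 - (w + μ⁻¹ • u) = (q.1 - w) - μ⁻¹ • u := by abel
    rw [hwu, e, norm_sub_sq_real (q.1 - w), norm_smul, mul_pow, Real.norm_eq_abs, sq_abs, inner_smul_right,
      inner_sub_left]
    have e2 : μ / 2 * (‖q.1 - w‖ ^ 2 - 2 * (μ⁻¹ * (inner ℝ q.1 u - inner ℝ w u))
        + μ⁻¹ ^ 2 * ‖u‖ ^ 2) = μ / 2 * ‖q.1 - w‖ ^ 2 - (inner ℝ q.1 u - inner ℝ w u)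
        + 1 / (2 * μ) * ‖u‖ ^ 2 := by
      field_simp
    have e3 : μ / 2 * (μ⁻¹ ^ 2 * ‖u‖ ^ 2) = 1 / (2 * μ) * ‖u‖ ^ 2 := by
      field_simp
    rw [e2, e3]
    linarith
  · have h1 := hgrow q hq
    have h2 : regValue μ w q - ε ≤ V := hglb _ fun q' hq' => by linarith [hε q' hq']
    have h3 : 1 / (2 * μ) * ‖q.1 - u‖ ^ 2 ≤ ε := by linarith
    have e : w + μ⁻¹ • q.1 - (w + μ⁻¹ • u) = μ⁻¹ • (q.1 - u) := by
      rw [smul_sub]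
      abel
    rw [e, ← Real.sqrt_mul (by norm_num)]
    apply Real.le_sqrt_of_sq_le
    rw [norm_smul, mul_pow, Real.norm_eq_abs, sq_abs]
    have : μ⁻¹ ^ 2 * ‖q.1 - u‖ ^ 2 = 2 * (1 / (2 * μ) * ‖q.1 - u‖ ^ 2 / μ) := by
      field_simp
    rw [this]
    gcongr

end DualProx

/-! ### Consequences of one perturbed Fejér step -/

section Fejer

variable {F : Type*} [NormedAddCommGroup F]

theorem IsProj.self_of_mem {C : Set F} {a : F} (ha : a ∈ C) : IsProj C a a :=
  ⟨ha, by rw [sub_self, norm_zero, Metric.infDist_zero_of_mem ha]⟩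

theorem norm_succ_sub_le {y p : ℕ → F} {e : ℕ → ℝ} (hyp : ∀ k, ‖y (k + 1) - p k‖ ≤ e k) {q : F}
    {d : ℕ → ℝ} (hd : ∀ k, 0 ≤ d k) (h : ∀ k, ‖p k - q‖ ^ 2 + d k ≤ ‖y k - q‖ ^ 2) (k : ℕ) :
    ‖y (k + 1) - q‖ ≤ ‖y k - q‖ + e k := by
  have h1 : ‖p k - q‖ ≤ ‖y k - q‖ :=
    (sq_le_sq₀ (norm_nonneg _) (norm_nonneg _)).1 (by linarith [h k, hd k])
  have := norm_sub_le_norm_sub_add_norm_sub (y (k + 1)) (p k) q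
  linarith [hyp k]

/-- The distances of `y k` and `p k` to `q` have the same limit, so the gap between their squares,
which dominates `d`, vanishes. -/
theorem tendsto_zero_of_sq_add_le {y p : ℕ → F} {e : ℕ → ℝ} (he : Summable e)
    (hyp : ∀ k, ‖y (k + 1) - p k‖ ≤ e k) {q : F} {d : ℕ → ℝ} (hd : ∀ k, 0 ≤ d k)
    (h : ∀ k, ‖p k - q‖ ^ 2 + d k ≤ ‖y k - q‖ ^ 2) : Tendsto d atTop (𝓝 0) := by
  obtain ⟨l, hl⟩ := exists_tendsto_of_le_add (fun k => norm_nonneg (y k - q))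
    (fun k => (norm_nonneg _).trans (hyp k)) he (norm_succ_sub_le hyp hd h)
  have h1 : Tendsto (fun k => ‖y (k + 1) - q‖ - ‖p k - q‖) atTop (𝓝 0) := by
    refine squeeze_zero_norm (fun k => ?_) he.tendsto_atTop_zero
    refine le_trans ?_ (hyp k)
    have := abs_norm_sub_norm_le (y (k + 1) - q) (p k - q)
    rwa [sub_sub_sub_cancel_right] at this
  have h2 : Tendsto (fun k => ‖p k - q‖) atTop (𝓝 l) := by
    have := ((tendsto_add_atTop_iff_nat 1).2 hl).sub h1
    simpa using this
  refine squeeze_zero hd (fun k => le_sub_iff_add_le'.2 (h k)) ?_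
  simpa using (hl.pow 2).sub (h2.pow 2)

theorem tendsto_of_mapClusterPt_sub {y p : ℕ → F} (h : Tendsto (fun k => y k - p k) atTop (𝓝 0))
    {a : F} (ha : MapClusterPt a atTop y) :
    ∃ φ : ℕ → ℕ, StrictMono φ ∧ Tendsto (y ∘ φ) atTop (𝓝 a) ∧ Tendsto (p ∘ φ) atTop (𝓝 a) := by
  obtain ⟨φ, hφ, hy⟩ := ha.tendsto_subseq
  refine ⟨φ, hφ, hy, ?_⟩
  have := hy.sub (h.comp hφ.tendsto_atTop)
  simpa [Function.comp_def] using this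

theorem mapClusterPt_succ {X : Type*} [TopologicalSpace X] {y : ℕ → X} {a : X}
    (ha : MapClusterPt a atTop y) : MapClusterPt a atTop fun k => y (k + 1) := by
  rw [mapClusterPt_iff_frequently] at ha ⊢
  intro s hs
  have h := ha s hs
  rw [frequently_atTop] at h ⊢
  intro N
  obtain ⟨n, hn, hns⟩ := h (N + 1)
  exact ⟨n - 1, by omega, by rwa [Nat.sub_add_cancel (by omega)]⟩

end Fejer

/-! ### Convergence of the projected dual proximal iteration -/

section DualMethod

variable {F : Type*} [NormedAddCommGroup F] [InnerProductSpace ℝ F]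

/-- The residual of the composition is the sum of two residuals; `‖a + b‖² ≤ 2 (‖a‖² + ‖b‖²)` costs
the factor `1 / 2`. -/
theorem norm_sq_add_le_of_prox_proj {A : Set (F × ℝ)} {C : Set F} (hC : Convex ℝ C) {μ : ℝ}
    (hμ : 0 < μ) {a b a' b' s t : F} (ha : IsProj C a a') (hb : IsProj C b b')
    (hs : IsDualProx A μ a' s) (ht : IsDualProx A μ b' t) :
    ‖s - t‖ ^ 2 + 1 / 2 * ‖(a - s) - (b - t)‖ ^ 2 ≤ ‖a - b‖ ^ 2 := by
  have h1 := ha.firmly_nonexpansive hC hb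
  have h2 := hs.firmly_nonexpansive hμ ht
  have e : (a - s) - (b - t) = ((a - a') - (b - b')) + ((a' - s) - (b' - t)) := by abel
  have h3 := parallelogram_law_with_norm ℝ ((a - a') - (b - b')) ((a' - s) - (b' - t))
  rw [e]
  nlinarith [mul_self_nonneg ‖((a - a') - (b - b')) - ((a' - s) - (b' - t))‖]

/-- `y` maximizes `M - (μ / 2) dist_C²`, where `M` has the hypograph `dualHyp A`. -/
def IsPenalizedSol (A : Set (F × ℝ)) (C : Set F) (μ : ℝ) (y : F) : Prop :=
  ∃ s, (y, s) ∈ dualHyp A ∧ ∀ q ∈ dualHyp A,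
    q.2 - μ / 2 * Metric.infDist q.1 C ^ 2 ≤ s - μ / 2 * Metric.infDist y C ^ 2

/-- The squared distance dominates its linearization at `y`, which turns the proximal growth
inequality into global optimality. -/
theorem isPenalizedSol_of_fixed {A : Set (F × ℝ)} {C : Set F} (hC : Convex ℝ C)
    (hne : C.Nonempty) (hcpt : IsCompact C) {μ : ℝ} (hμ : 0 < μ) {y w : F} (hw : IsProj C y w)
    (hy : IsDualProx A μ w y) : IsPenalizedSol A C μ y := by
  obtain ⟨s, hs, h⟩ := hy
  refine ⟨s, hs, fun q hq => ?_⟩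
  have h1 := h q hq
  have h2 := hw.norm_sq_sub_le hC hne hcpt (η := q.1)
  rw [← hw.2, norm_sub_rev w y]
  have h3 := mul_le_mul_of_nonneg_left h2 (half_pos hμ).le
  linarith

theorem IsPenalizedSol.isDualProx {A : Set (F × ℝ)} {C : Set F} {μ : ℝ} (hμ : 0 < μ) {y w p : F}
    (hw : IsProj C y w) (hp : IsDualProx A μ w p) (hy : IsPenalizedSol A C μ y) :
    IsDualProx A μ w y := by
  suffices p = y from this ▸ hp
  obtain ⟨s, hs, h⟩ := hy
  obtain ⟨t, ht, h'⟩ := hp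
  have h1 := h _ ht
  have h2 := h' _ hs
  have h3 : Metric.infDist p C ≤ ‖p - w‖ := by
    rw [← dist_eq_norm]
    exact Metric.infDist_le_dist_of_mem hw.1
  have h4 : Metric.infDist p C ^ 2 ≤ ‖p - w‖ ^ 2 :=
    pow_le_pow_left₀ Metric.infDist_nonneg h3 2
  rw [← hw.2, norm_sub_rev w y] at h1
  have h5 : ‖y - p‖ ^ 2 ≤ 0 := by
    simp only at h1 h2
    have := mul_le_mul_of_nonneg_left h4 (half_pos hμ).le
    nlinarith
  have h6 : ‖y - p‖ = 0 := by
    nlinarith [sq_nonneg ‖y - p‖]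
  exact (sub_eq_zero.1 (norm_eq_zero.1 h6)).symm

theorem le_of_mem_dualHyp {A : Set (F × ℝ)} {r₀ : ℝ} (h0 : (0, r₀) ∈ A) {q : F × ℝ}
    (hq : q ∈ dualHyp A) : q.2 ≤ r₀ := by
  simpa using hq _ h0

variable [FiniteDimensional ℝ F]

theorem exists_isPenalizedSol {A : Set (F × ℝ)} {r₀ : ℝ} (h0 : (0, r₀) ∈ A) {C : Set F}
    (hne : C.Nonempty) (hcpt : IsCompact C) (hB : (dualHyp A).Nonempty) {μ : ℝ} (hμ : 0 < μ) :
    ∃ y, IsPenalizedSol A C μ y := by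
  obtain ⟨b, hb⟩ := hB
  set v : F × ℝ → ℝ := fun q => q.2 - μ / 2 * Metric.infDist q.1 C ^ 2 with hv
  have hvc : Continuous v := by
    have := Metric.continuous_infDist_pt C
    fun_prop
  -- A superlevel set is compact: `M ≤ r₀` bounds the distance to `C`, and `C` is bounded.
  set K : Set (F × ℝ) := dualHyp A ∩ {q | v b ≤ v q} with hK
  have hKc : IsClosed K := (isClosed_dualHyp A).inter (isClosed_le continuous_const hvc)
  obtain ⟨R, hR⟩ := hcpt.isBounded.exists_norm_le
  have hKb : K ⊆ Metric.closedBall 0 (Real.sqrt (2 / μ * (r₀ - v b)) + R) ×ˢ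
      Set.Icc (v b) r₀ := by
    rintro q ⟨hq, hqb⟩
    have h1 := le_of_mem_dualHyp h0 hq
    have h2 : v b ≤ q.2 - μ / 2 * Metric.infDist q.1 C ^ 2 := hqb
    have h3 : 0 ≤ μ / 2 * Metric.infDist q.1 C ^ 2 := by positivity
    refine ⟨?_, by linarith, h1⟩
    obtain ⟨p, hp⟩ := exists_isProj hne hcpt q.1
    have h4 : Metric.infDist q.1 C ≤ Real.sqrt (2 / μ * (r₀ - v b)) := by
      apply Real.le_sqrt_of_sq_le
      have : 2 / μ * (μ / 2 * Metric.infDist q.1 C ^ 2) ≤ 2 / μ * (r₀ - v b) := by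
        gcongr
        linarith
      refine le_trans (le_of_eq ?_) this
      field_simp
    rw [mem_closedBall_zero_iff]
    have h5 := norm_add_le (q.1 - p) p
    rw [sub_add_cancel, norm_sub_rev, hp.2] at h5
    linarith [hR p hp.1]
  have hKcpt : IsCompact K :=
    ((isCompact_closedBall _ _).prod isCompact_Icc).of_isClosed_subset hKc hKb
  obtain ⟨q, hqK, hq⟩ := hKcpt.exists_isMaxOn ⟨b, hb, le_refl (v b)⟩ hvc.continuousOn
  refine ⟨q.1, q.2, hqK.1, fun q' hq' => ?_⟩
  by_cases h : v b ≤ v q'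
  · exact hq (show q' ∈ K from ⟨hq', h⟩)
  · exact (not_le.1 h).le.trans hqK.2

theorem exists_tendsto_of_constant {A : Set (F × ℝ)} (hA : Convex ℝ A) {r₀ : ℝ}
    (h0 : (0, r₀) ∈ A) (hB : (dualHyp A).Nonempty) {C : Set F} (hC : Convex ℝ C)
    (hne : C.Nonempty) (hcpt : IsCompact C) {μ : ℝ} (hμ : 0 < μ) {y yhat p : ℕ → F} {e : ℕ → ℝ}
    (he : Summable e) (hproj : ∀ k, IsProj C (y k) (yhat k))
    (hp : ∀ k, IsDualProx A μ (yhat k) (p k)) (hyp : ∀ k, ‖y (k + 1) - p k‖ ≤ e k) :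
    ∃ a, IsPenalizedSol A C μ a ∧ Tendsto y atTop (𝓝 a) := by
  have hprox := fun w => exists_isDualProx hA ⟨_, h0⟩ hB hμ w
  have key : ∀ q, IsPenalizedSol A C μ q → ∀ k,
      ‖p k - q‖ ^ 2 + 1 / 2 * ‖y k - p k‖ ^ 2 ≤ ‖y k - q‖ ^ 2 := fun q hq k => by
    obtain ⟨w, hw⟩ := exists_isProj hne hcpt q
    obtain ⟨t, ht, -⟩ := hprox w
    have := norm_sq_add_le_of_prox_proj hC hμ (hproj k) hw (hp k) (hq.isDualProx hμ hw ht)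
    rwa [sub_self, sub_zero] at this
  have hnn : ∀ k, 0 ≤ 1 / 2 * ‖y k - p k‖ ^ 2 := fun k => by positivity
  obtain ⟨q, hq⟩ := exists_isPenalizedSol h0 hne hcpt hB hμ
  refine exists_tendsto_of_quasiFejer (S := {a | IsPenalizedSol A C μ a}) ⟨q, hq⟩
    (fun k => (norm_nonneg _).trans (hyp k)) he
    (fun q hq => norm_succ_sub_le hyp hnn (key q hq)) fun a ha => ?_
  have h1 := (tendsto_zero_of_sq_add_le he hyp hnn (key q hq)).const_mul 2
  have h2 : Tendsto (fun k => y k - p k) atTop (𝓝 0) := by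
    rw [tendsto_zero_iff_norm_tendsto_zero]
    have h3 := h1.sqrt
    simp only [mul_zero, Real.sqrt_zero] at h3
    refine h3.congr fun k => ?_
    rw [← mul_assoc, mul_one_div_cancel two_ne_zero, one_mul, Real.sqrt_sq (norm_nonneg _)]
  obtain ⟨φ, -, hφy, hφp⟩ := tendsto_of_mapClusterPt_sub h2 ha
  obtain ⟨w, hw⟩ := exists_isProj hne hcpt a
  obtain ⟨t, ht, -⟩ := hprox w
  -- Nonexpansiveness sends `p ∘ φ` to the image `t` of `a`, while the vanishing residual sends it
  -- to `a`; so `a` is a fixed point.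
  have h4 : Tendsto (p ∘ φ) atTop (𝓝 t) := by
    refine tendsto_iff_norm_sub_tendsto_zero.2 (squeeze_zero (fun _ => norm_nonneg _) (fun k => ?_)
      (tendsto_iff_norm_sub_tendsto_zero.1 hφy))
    refine (sq_le_sq₀ (norm_nonneg _) (norm_nonneg _)).1 ?_
    have := norm_sq_add_le_of_prox_proj hC hμ (hproj (φ k)) hw (hp (φ k)) ht
    have h5 : 0 ≤ 1 / 2 * ‖y (φ k) - p (φ k) - (a - t)‖ ^ 2 := by positivity
    simp only [Function.comp_apply]
    linarith
  rw [tendsto_nhds_unique h4 hφp] at ht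
  exact isPenalizedSol_of_fixed hC hne hcpt hμ hw ht

omit [FiniteDimensional ℝ F] in
theorem isBounded_range_of_dualProx {A : Set (F × ℝ)} {r₀ : ℝ} (h0 : (0, r₀) ∈ A) {b : F}
    (hb : (b, r₀) ∈ dualHyp A) {C : Set F} (hcpt : IsCompact C) {μ : ℕ → ℝ} (hμ : ∀ k, 0 < μ k)
    {y yhat p : ℕ → F} {e : ℕ → ℝ} (he : Summable e) (hproj : ∀ k, yhat k ∈ C)
    (hp : ∀ k, IsDualProx A (μ k) (yhat k) (p k)) (hyp : ∀ k, ‖y (k + 1) - p k‖ ≤ e k) :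
    Bornology.IsBounded (Set.range y) := by
  obtain ⟨R, hR⟩ := hcpt.isBounded.exists_norm_le
  obtain ⟨M, hM⟩ := he.tendsto_atTop_zero.bddAbove_range
  have h : ∀ k, y (k + 1) ∈ Metric.closedBall b (M + (R + ‖b‖)) := fun k => by
    rw [mem_closedBall_iff_norm]
    have h1 := (hp k).nonexpansive (hμ k) (isDualProx_self h0 hb)
    have h2 := norm_sub_le (yhat k) b
    have h3 := hR _ (hproj k)
    have h4 := norm_sub_le_norm_sub_add_norm_sub (y (k + 1)) (p k) b
    have h5 : e k ≤ M := hM ⟨k, rfl⟩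
    linarith [hyp k]
  refine ((Metric.isBounded_closedBall (x := b) (r := M + (R + ‖b‖))).union
    (Bornology.isBounded_singleton (x := y 0))).subset ?_
  rintro _ ⟨k, rfl⟩
  cases k with
  | zero => exact Or.inr rfl
  | succ k => exact Or.inl (h k)

omit [FiniteDimensional ℝ F] in
theorem mem_dualHyp_of_mapClusterPt {A : Set (F × ℝ)} {r₀ : ℝ} {b : F}
    (hb : (b, r₀) ∈ dualHyp A) {C : Set F} (hcpt : IsCompact C) {μ : ℕ → ℝ} (hμ : ∀ k, 0 < μ k)
    (hμ0 : Tendsto μ atTop (𝓝 0))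
    {y yhat p : ℕ → F} {e : ℕ → ℝ} (he : Summable e) (hproj : ∀ k, yhat k ∈ C)
    (hp : ∀ k, IsDualProx A (μ k) (yhat k) (p k)) (hyp : ∀ k, ‖y (k + 1) - p k‖ ≤ e k) {a : F}
    (ha : MapClusterPt a atTop y) : (a, r₀) ∈ dualHyp A := by
  obtain ⟨R, hR⟩ := hcpt.isBounded.exists_norm_le
  have h1 : Tendsto (fun k => y (k + 1) - p k) atTop (𝓝 0) :=
    squeeze_zero_norm hyp he.tendsto_atTop_zero
  obtain ⟨φ, hφ, -, hφp⟩ := tendsto_of_mapClusterPt_sub h1 (mapClusterPt_succ ha)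
  set c : ℕ → ℝ := fun k => μ k / 2 * (R + ‖b‖) ^ 2
  have hc : Tendsto c atTop (𝓝 0) := by
    simpa using (hμ0.div_const 2).mul_const ((R + ‖b‖) ^ 2)
  -- Comparing the proximal value with that at `b` loses at most `μ k / 2 * ‖b - yhat k‖²`, which
  -- tends to zero.
  have h2 : ∀ k, (p k, r₀ - c k) ∈ dualHyp A := fun k => by
    obtain ⟨s, hs, h⟩ := hp k
    have h3 := h _ hb
    have h4 : ‖b - yhat k‖ ≤ R + ‖b‖ := by
      linarith [norm_sub_le b (yhat k), hR _ (hproj k)]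
    have h5 : μ k / 2 * ‖b - yhat k‖ ^ 2 ≤ c k := by
      have := (hμ k).le
      simp only [c]
      gcongr
    have h6 : 0 ≤ μ k / 2 * ‖b - p k‖ ^ 2 := by have := hμ k; positivity
    have h7 : 0 ≤ μ k / 2 * ‖p k - yhat k‖ ^ 2 := by have := hμ k; positivity
    intro q hq
    have h8 := hs q hq
    simp only at h3 h8 ⊢
    linarith
  have h3 : Tendsto (fun k => (p (φ k), r₀ - c (φ k))) atTop (𝓝 (a, r₀ - 0)) :=
    hφp.prodMk_nhds ((hc.comp hφ.tendsto_atTop).const_sub r₀)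
  rw [sub_zero] at h3
  exact (isClosed_dualHyp A).mem_of_tendsto h3 (Eventually.of_forall fun k => h2 _)

theorem exists_tendsto_inter_of_tendsto_zero {A : Set (F × ℝ)} {r₀ : ℝ} (h0 : (0, r₀) ∈ A)
    {C : Set F} (hC : Convex ℝ C)
    (hcpt : IsCompact C) {μ : ℕ → ℝ} (hμ : ∀ k, 0 < μ k) (hμ0 : Tendsto μ atTop (𝓝 0))
    {y yhat p : ℕ → F} {e : ℕ → ℝ} (he : Summable e) (hproj : ∀ k, IsProj C (y k) (yhat k))
    (hp : ∀ k, IsDualProx A (μ k) (yhat k) (p k)) (hyp : ∀ k, ‖y (k + 1) - p k‖ ≤ e k)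
    (hne : ∃ b ∈ C, (b, r₀) ∈ dualHyp A) :
    ∃ a ∈ C, (a, r₀) ∈ dualHyp A ∧ Tendsto y atTop (𝓝 a) := by
  have key : ∀ b ∈ C, (b, r₀) ∈ dualHyp A → ∀ k,
      ‖p k - b‖ ^ 2 + ‖y k - yhat k‖ ^ 2 ≤ ‖y k - b‖ ^ 2 := fun b hbC hb k => by
    have h1 := (hproj k).firmly_nonexpansive hC (IsProj.self_of_mem hbC)
    have h2 := (hp k).nonexpansive (hμ k) (isDualProx_self h0 hb)
    rw [sub_self, sub_zero] at h1
    have h3 := pow_le_pow_left₀ (norm_nonneg _) h2 2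
    linarith
  have hnn : ∀ k, 0 ≤ ‖y k - yhat k‖ ^ 2 := fun k => by positivity
  obtain ⟨b, hbC, hb⟩ := hne
  obtain ⟨a, ⟨haC, ha⟩, h⟩ := exists_tendsto_of_quasiFejer
    (S := {b | b ∈ C ∧ (b, r₀) ∈ dualHyp A}) ⟨b, hbC, hb⟩
    (fun k => (norm_nonneg _).trans (hyp k)) he
    (fun q hq => norm_succ_sub_le hyp hnn (key q hq.1 hq.2)) fun a ha => by
      refine ⟨?_, mem_dualHyp_of_mapClusterPt hb hcpt hμ hμ0 he (fun k => (hproj k).1)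
        hp hyp ha⟩
      have h1 := (tendsto_zero_of_sq_add_le he hyp hnn (key b hbC hb)).sqrt
      have h2 : Tendsto (fun k => y k - yhat k) atTop (𝓝 0) := by
        rw [tendsto_zero_iff_norm_tendsto_zero]
        simpa using h1
      obtain ⟨φ, -, -, hφ⟩ := tendsto_of_mapClusterPt_sub h2 ha
      exact hcpt.isClosed.mem_of_tendsto hφ (Eventually.of_forall fun k => (hproj _).1)
  exact ⟨a, haC, ha, h⟩

omit [FiniteDimensional ℝ F] in
-- At `b` the penalty is zero and `M` is maximal, so every solution must achieve both.
theorem IsPenalizedSol.mem_inter {A : Set (F × ℝ)} {r₀ : ℝ} (h0 : (0, r₀) ∈ A) {C : Set F}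
    (hcl : IsClosed C) {μ : ℝ} (hμ : 0 < μ) {b : F} (hbC : b ∈ C) (hb : (b, r₀) ∈ dualHyp A)
    {a : F} (ha : IsPenalizedSol A C μ a) : a ∈ C ∧ (a, r₀) ∈ dualHyp A := by
  obtain ⟨s, hs, h⟩ := ha
  have h1 := h _ hb
  have h2 : s ≤ r₀ := le_of_mem_dualHyp h0 hs
  simp only [Metric.infDist_zero_of_mem hbC] at h1
  have h3 : 0 ≤ μ / 2 * Metric.infDist a C ^ 2 := by positivity
  have h4 : s = r₀ := by linarith
  have h5 : μ / 2 * Metric.infDist a C ^ 2 = 0 := by linarith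
  have h6 : Metric.infDist a C = 0 := by
    rcases mul_eq_zero.1 h5 with h | h
    · linarith
    · exact pow_eq_zero_iff (by norm_num) |>.1 h
  exact ⟨(hcl.mem_iff_infDist_zero ⟨b, hbC⟩).2 h6, h4 ▸ hs⟩

end DualMethod

/-! ### The penalty parameters -/

theorem pos_of_update {μ : ℕ → ℝ} {β : ℝ} (h0 : 0 < μ 0)
    (h : ∀ k, ∃ βk ∈ Set.Ioc 0 β ∪ {1}, μ (k + 1) = βk * μ k) (k : ℕ) : 0 < μ k := by
  induction k with
  | zero => exact h0
  | succ k ih =>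
    obtain ⟨b, hb, e⟩ := h k
    rw [e]
    refine mul_pos ?_ ih
    rcases hb with hb | hb
    · exact hb.1
    · rw [Set.mem_singleton_iff.1 hb]
      exact one_pos

/-- Successive ratios tend to `1 > β`, so eventually only the factor `1` is possible. -/
theorem eventually_eq_of_update {μ : ℕ → ℝ} {β : ℝ} (hβ : β < 1) (h0 : 0 < μ 0)
    (h : ∀ k, ∃ βk ∈ Set.Ioc 0 β ∪ {1}, μ (k + 1) = βk * μ k) {l : ℝ} (hl : 0 < l)
    (hμ : Tendsto μ atTop (𝓝 l)) : ∃ K, ∀ k, μ (k + K) = l := by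
  have h1 : Tendsto (fun k => μ (k + 1) / μ k) atTop (𝓝 1) := by
    rw [← div_self hl.ne']
    exact ((tendsto_add_atTop_iff_nat 1).2 hμ).div hμ hl.ne'
  obtain ⟨K, hK⟩ := eventually_atTop.1 (h1.eventually (lt_mem_nhds hβ))
  have h2 : ∀ k, μ (k + K) = μ K := fun k => by
    induction k with
    | zero => rw [zero_add]
    | succ k ih =>
      obtain ⟨b, hb, e⟩ := h (k + K)
      have h3 := hK (k + K) (by omega)
      rw [e, mul_div_cancel_right₀ _ (pos_of_update h0 h _).ne'] at h3
      rcases hb with hb | hb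
      · exact absurd h3 (not_lt.2 hb.2)
      · rw [Set.mem_singleton_iff.1 hb, one_mul] at e
        rw [add_right_comm, e, ih]
  refine ⟨K, fun k => (h2 k).trans ?_⟩
  refine tendsto_nhds_unique ?_ ((tendsto_add_atTop_iff_nat K).2 hμ)
  simp only [h2]
  exact tendsto_const_nhds

/-! ### Extended real inequalities tested on real bounds -/

section ERealBounds

theorem coe_le_coe_add_iff {s a : ℝ} {X : EReal} :
    (s : EReal) ≤ (a : EReal) + X ↔ ((s - a : ℝ) : EReal) ≤ X := by
  induction X with
  | bot => simp only [EReal.add_bot, le_bot_iff, EReal.coe_ne_bot]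
  | coe x =>
    rw [← EReal.coe_add, EReal.coe_le_coe_iff, EReal.coe_le_coe_iff]
    exact sub_le_iff_le_add'.symm
  | top => simp

theorem coe_le_add_coe_iff {t b : ℝ} {X : EReal} :
    (t : EReal) ≤ X + (b : EReal) ↔ ∀ ρ : ℝ, X ≤ ρ → t ≤ ρ + b := by
  induction X with
  | bot =>
    simp only [EReal.bot_add, le_bot_iff, EReal.coe_ne_bot, bot_le, forall_const, false_iff,
      not_forall, not_le]
    exact ⟨t - b - 1, by linarith⟩
  | coe x =>
    simp only [← EReal.coe_add, EReal.coe_le_coe_iff]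
    exact ⟨fun h ρ hρ => by linarith, fun h => h x le_rfl⟩
  | top => simp

end ERealBounds

/-! ### Subgradients, horizons and conjugates -/

section Convex

variable {F : Type*} [NormedAddCommGroup F] [InnerProductSpace ℝ F]

omit [NormedAddCommGroup F] [InnerProductSpace ℝ F] in
theorem IsProper.exists_coe {g : F → EReal} (hg : IsProper g) {z : F} (hz : g z < ⊤) :
    ∃ ρ : ℝ, g z = ρ :=
  ⟨(g z).toReal, (EReal.coe_toReal hz.ne (hg.2 z)).symm⟩

omit [InnerProductSpace ℝ F] in
theorem isClosed_epigraph_coe {g : F → EReal} (hg : LowerSemicontinuous g) :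
    IsClosed {p : F × ℝ | g p.1 ≤ (p.2 : EReal)} :=
  hg.isClosed_epigraph.preimage (continuous_fst.prodMk (continuous_coe_real_ereal.comp
    continuous_snd))

theorem IsConvex.le_combo {g : F → EReal} (hg : IsConvex g) {z z' : F} {ρ ρ' : ℝ} (h : g z ≤ ρ)
    (h' : g z' ≤ ρ') {a b : ℝ} (ha : 0 ≤ a) (hb : 0 ≤ b) (hab : a + b = 1) :
    g (a • z + b • z') ≤ ((a * ρ + b * ρ' : ℝ) : EReal) :=
  hg (x := (z, ρ)) h (y := (z', ρ')) h' ha hb hab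

theorem inner_le_zero_of_mem_hzn {g : F → EReal} {w a d : F} (ha : a ∈ subdiff g w)
    (hd : d ∈ hzn g) : inner ℝ a d ≤ 0 := by
  obtain ⟨h1, h2, h3⟩ := ha
  have hle := hd w (lt_top_iff_ne_top.2 h1)
  have h4 := (h3 (w + d) (hle.trans_lt (lt_top_iff_ne_top.2 h1))).trans hle
  lift g w to ℝ using ⟨h1, h2⟩ with γ
  rw [add_sub_cancel_left, ← EReal.coe_add, EReal.coe_le_coe_iff] at h4
  linarith

theorem subdiff_le {g : F → EReal} {w a z : F} {γ ρ : ℝ} (ha : a ∈ subdiff g w) (hw : g w = γ)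
    (hz : g z ≤ ρ) : γ + inner ℝ a (z - w) ≤ ρ := by
  have := (ha.2.2 z (hz.trans_lt (EReal.coe_lt_top ρ))).trans hz
  rwa [hw, ← EReal.coe_add, EReal.coe_le_coe_iff] at this

theorem mem_subdiff_of_forall_le {g : F → EReal} {w a : F} {γ : ℝ} (hw : g w = γ)
    (h : ∀ z, ∀ ρ : ℝ, g z ≤ ρ → γ + inner ℝ a (z - w) ≤ ρ) : a ∈ subdiff g w := by
  refine ⟨hw ▸ EReal.coe_ne_top γ, hw ▸ EReal.coe_ne_bot γ, fun z hz => ?_⟩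
  rw [hw, ← EReal.coe_add]
  refine EReal.le_of_forall_lt_iff_le.1 fun ρ hρ => ?_
  exact EReal.coe_le_coe_iff.2 (h z ρ hρ.le)

variable [CompleteSpace F]

/-- A closed convex function has, at a point of its domain, an affine minorant that is exact up to
`δ`. -/
theorem exists_approx_subgradient {g : F → EReal} (hc : IsConvex g) (hl : LowerSemicontinuous g)
    {w : F} {γ : ℝ} (hw : g w = γ) {δ : ℝ} (hδ : 0 < δ) :
    ∃ v : F, ∀ z, ∀ ρ : ℝ, g z ≤ ρ → γ - δ + inner ℝ v (z - w) ≤ ρ := by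
  have hnot : (w, γ - δ) ∉ {p : F × ℝ | g p.1 ≤ (p.2 : EReal)} := by
    simp only [Set.mem_ofPred_eq, hw, EReal.coe_le_coe_iff, not_le]
    linarith
  obtain ⟨L, u, h1, h2⟩ := geometric_hahn_banach_point_closed hc (isClosed_epigraph_coe hl) hnot
  set t := L (0, 1) with ht
  have hL : ∀ z r, L (z, r) = L (z, 0) + r * t := fun z r => by
    have e : (z, r) = (z, 0) + r • ((0, 1) : F × ℝ) := by simp
    rw [e, map_add, map_smul, smul_eq_mul]
  obtain ⟨v, hv⟩ : ∃ v : F, ∀ z, L (z, 0) = inner ℝ v z := by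
    refine ⟨(InnerProductSpace.toDual ℝ F).symm (L.comp (ContinuousLinearMap.inl ℝ F ℝ)),
      fun z => ?_⟩
    rw [InnerProductSpace.toDual_symm_apply]
    rfl
  have h3 := h1.trans (h2 (w, γ) (by simp [hw]))
  rw [hL, hL w γ] at h3
  -- The hyperplane is not vertical: it separates `(w, γ - δ)` from `(w, γ)`, directly above it.
  have htpos : 0 < t := by
    by_contra! h
    nlinarith
  refine ⟨-(t⁻¹ • v), fun z ρ hz => ?_⟩
  have h4 := h1.trans (h2 (z, ρ) hz)
  rw [hL, hL z ρ, hv, hv] at h4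
  rw [inner_neg_left, inner_smul_left, inner_sub_right, conj_trivial]
  have h5 : t * (γ - δ + -(t⁻¹ * (inner ℝ v z - inner ℝ v w))) ≤ t * ρ := by
    have : t * (γ - δ + -(t⁻¹ * (inner ℝ v z - inner ℝ v w))) =
        t * (γ - δ) - (inner ℝ v z - inner ℝ v w) := by
      field_simp
      ring
    linarith
  exact le_of_mul_le_mul_left h5 htpos

/-- Approximate subgradients `v` at `w` satisfy `g*(v) ≤ ⟨w, v⟩ - γ + δ`. Inserted in the
subgradient inequality for `g*` at `y`, this gives `g*(y) ≤ ⟨w, y⟩ - γ` as `δ → 0`. -/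
theorem mem_subdiff_of_mem_subdiff_conj {g : F → EReal} (hc : IsConvex g)
    (hl : LowerSemicontinuous g) {w y : F} {γ : ℝ} (hw : g w = γ) (h : w ∈ subdiff (conj g) y) :
    y ∈ subdiff g w := by
  obtain ⟨h1, h2, h3⟩ := h
  obtain ⟨κ, hκ⟩ : ∃ κ : ℝ, conj g y = κ := ⟨_, (EReal.coe_toReal h1 h2).symm⟩
  have hκle : κ ≤ inner ℝ w y - γ := by
    refine le_of_forall_pos_le_add fun δ hδ => ?_
    obtain ⟨v, hv⟩ := exists_approx_subgradient hc hl hw hδ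
    have h4 : conj g v ≤ ((inner ℝ w v - γ + δ : ℝ) : EReal) := by
      refine iSup_le fun z => ?_
      induction hz : g z with
      | bot =>
        have := hv z (γ - δ + inner ℝ v (z - w) - 1) (by simp [hz])
        linarith
      | coe ρ =>
        have := hv z ρ hz.le
        rw [inner_sub_right, real_inner_comm z v, real_inner_comm w v] at this
        rw [← EReal.coe_sub, EReal.coe_le_coe_iff]
        linarith
      | top => simp
    have h5 := (h3 v (h4.trans_lt (EReal.coe_lt_top _))).trans h4
    rw [hκ, ← EReal.coe_add, EReal.coe_le_coe_iff, inner_sub_right] at h5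
    linarith
  refine mem_subdiff_of_forall_le hw fun z ρ hz => ?_
  have h4 : ((inner ℝ z y - ρ : ℝ) : EReal) ≤ κ := by
    rw [← hκ, EReal.coe_sub]
    exact (EReal.sub_le_sub le_rfl hz).trans (le_iSup (fun z => ((inner ℝ z y : ℝ) : EReal) - g z) z)
  rw [EReal.coe_le_coe_iff] at h4
  rw [inner_sub_right, real_inner_comm z y, real_inner_comm w y]
  linarith

end Convex

theorem le_of_convexOn_of_hasFDerivAt_zero {E : Type*} [NormedAddCommGroup E] [NormedSpace ℝ E]
    {h : E → ℝ} (hc : ConvexOn ℝ Set.univ h) {x : E} (hx : HasFDerivAt h (0 : E →L[ℝ] ℝ) x)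
    (x' : E) : h x ≤ h x' := by
  have hc' : ConvexOn ℝ Set.univ (h ∘ AffineMap.lineMap x x' : ℝ → ℝ) :=
    hc.comp_affineMap _
  have hd : HasDerivAt (h ∘ AffineMap.lineMap x x' : ℝ → ℝ) 0 0 := by
    have h1 : HasDerivAt (AffineMap.lineMap x x' : ℝ → E) (x' - x) 0 := AffineMap.hasDerivAt_lineMap
    have h2 : HasFDerivAt h (0 : E →L[ℝ] ℝ) (AffineMap.lineMap x x' (0 : ℝ)) := by
      rwa [AffineMap.lineMap_apply_zero]
    simpa using h2.comp_hasDerivAt (0 : ℝ) h1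
  have := hc'.le_slope_of_hasDerivAt (Set.mem_univ 0) (Set.mem_univ 1) one_pos hd
  rw [slope_def_field] at this
  simpa using this

/-! ### The value set of the composite problem and its dual -/

section Composite

variable {E F : Type*} [NormedAddCommGroup E] [InnerProductSpace ℝ E]
  [NormedAddCommGroup F] [InnerProductSpace ℝ F]

/-- The attained upper bounds `(u, r)`, `f x + g (c x - u) ≤ r`, of the value function
`u ↦ inf_x {f x + g (c x - u)}` of the perturbed problem. -/
def valueSet (f : E → ℝ) (g : F → EReal) (c : E → F) : Set (F × ℝ) :=
  {p | ∃ x, ∃ ρ : ℝ, g (c x - p.1) ≤ ρ ∧ f x + ρ = p.2}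

variable {f : E → ℝ} {g : F → EReal} {c : E → F}

omit [NormedAddCommGroup E] [InnerProductSpace ℝ E] [InnerProductSpace ℝ F] in
theorem mem_valueSet {x : E} {z : F} {ρ : ℝ} (h : g z ≤ ρ) :
    (c x - z, f x + ρ) ∈ valueSet f g c :=
  ⟨x, ρ, by simpa using h, rfl⟩

theorem FullyConvex.convex_valueSet (hP : FullyConvex f g c) : Convex ℝ (valueSet f g c) := by
  rintro ⟨u, r⟩ ⟨x, ρ, h, rfl⟩ ⟨u', r'⟩ ⟨x', ρ', h', rfl⟩ a b ha hb hab
  have hd := hP.c_convex x x' a ⟨ha, by linarith⟩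
  obtain rfl : b = 1 - a := by linarith
  have h1 := hP.g_convex.le_combo h h' ha hb hab
  have h2 := (hd _ (h1.trans_lt (EReal.coe_lt_top _))).trans h1
  have hf := hP.f_convex.2 (Set.mem_univ x) (Set.mem_univ x') ha hb hab
  -- The bound on `g` is chosen to make the second coordinate exact; it absorbs the slack in the
  -- convexity of `f`.
  refine ⟨a • x + (1 - a) • x', a * (f x + ρ) + (1 - a) * (f x' + ρ')
    - f (a • x + (1 - a) • x'), ?_, by simp⟩
  simp only [smul_eq_mul] at hf
  refine le_trans (le_trans (le_of_eq (congrArg g ?_)) h2) (EReal.coe_le_coe_iff.2 (by linarith))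
  simp only [Prod.fst_add, Prod.smul_fst, smul_sub]
  abel

omit [NormedAddCommGroup E] [InnerProductSpace ℝ E] in
theorem coe_le_dualObjective_iff {s : ℝ} {η : F} :
    (s : EReal) ≤ dualObjective f g c η ↔ (η, s) ∈ dualHyp (valueSet f g c) := by
  simp only [dualObjective, lagrangian, le_iInf_iff, coe_le_coe_add_iff, coe_le_add_coe_iff]
  constructor
  · rintro h ⟨u, r⟩ ⟨x, ρ, hρ, rfl⟩
    have := h x _ ρ hρ
    simp only [sub_sub_cancel] at this ⊢
    linarith
  · intro h x z ρ hρ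
    have := h _ (mem_valueSet (x := x) hρ)
    simp only at this
    linarith

omit [NormedAddCommGroup E] [InnerProductSpace ℝ E] in
theorem dualObjective_le {r₀ : ℝ} (h0 : (0, r₀) ∈ valueSet f g c) (η : F) :
    dualObjective f g c η ≤ r₀ := by
  refine EReal.ge_of_forall_gt_iff_ge.1 fun s hs => EReal.coe_le_coe_iff.2 ?_
  exact le_of_mem_dualHyp h0 (coe_le_dualObjective_iff.1 hs.le)

omit [NormedAddCommGroup E] [InnerProductSpace ℝ E] in
theorem IsPenalizedSol.solves {r₀ : ℝ} (h0 : (0, r₀) ∈ valueSet f g c) {C : Set F} {μ : ℝ}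
    {a : F} (ha : IsPenalizedSol (valueSet f g c) C μ a) : SolvesPenalizedDual f g c C μ a := by
  obtain ⟨s, hs, h⟩ := ha
  have hM : dualObjective f g c a = s := by
    refine le_antisymm ?_ (coe_le_dualObjective_iff.2 hs)
    refine EReal.ge_of_forall_gt_iff_ge.1 fun s' hs' => EReal.coe_le_coe_iff.2 ?_
    have := h _ (coe_le_dualObjective_iff.1 hs'.le)
    simp only at this
    linarith
  refine ⟨?_, fun y' => ?_⟩
  · rw [penalizedDual, hM, ← EReal.coe_neg, ← EReal.coe_add]
    exact EReal.coe_lt_top _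
  · rw [penalizedDual, penalizedDual, hM]
    induction hy : dualObjective f g c y' with
    | bot =>
      rw [EReal.neg_bot, EReal.top_add_coe]
      exact le_top
    | coe m =>
      have := h _ (coe_le_dualObjective_iff.1 hy.ge)
      simp only at this
      rw [← EReal.coe_neg, ← EReal.coe_neg, ← EReal.coe_add, ← EReal.coe_add,
        EReal.coe_le_coe_iff]
      linarith
    | top =>
      have := dualObjective_le h0 y'
      rw [hy, top_le_iff] at this
      exact absurd this (EReal.coe_ne_top _)

theorem FullyConvex.convexOn_add_inner (hP : FullyConvex f g c) {w a : F}
    (ha : a ∈ subdiff g w) : ConvexOn ℝ Set.univ fun x => f x + inner ℝ a (c x) := by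
  refine ⟨convex_univ, fun x _ x' _ s t hs ht hst => ?_⟩
  have hf := hP.f_convex.2 (Set.mem_univ x) (Set.mem_univ x') hs ht hst
  obtain rfl : t = 1 - s := by linarith
  have hd := inner_le_zero_of_mem_hzn ha (hP.c_convex x x' s ⟨hs, by linarith⟩)
  rw [inner_sub_right, inner_sub_right, inner_smul_right, inner_smul_right] at hd
  simp only [smul_eq_mul] at hf ⊢
  linarith

/-- A multiplier makes `f + ⟨a, c⟩` convex with a critical point, hence a global minimum, at `x`.
Conversely, freezing `x` in the dual bound gives the subgradient inequality, and freezing `z = c x`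
gives the minimum. -/
theorem FullyConvex.mem_multipliers_iff (hP : FullyConvex f g c) {x : E} {γ : ℝ}
    (hx : g (c x) = γ) {a : F} :
    a ∈ multipliers f g c x ↔ (a, f x + γ) ∈ dualHyp (valueSet f g c) := by
  constructor
  · rintro ⟨ha, hgrad⟩ ⟨u, r⟩ ⟨x', ρ, hρ, rfl⟩
    have h1 := le_of_convexOn_of_hasFDerivAt_zero (hP.convexOn_add_inner ha) hgrad x'
    have h2 := subdiff_le ha hx hρ
    rw [inner_sub_right, inner_sub_right] at h2
    simp only at h1 ⊢
    linarith
  · intro h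
    constructor
    · refine mem_subdiff_of_forall_le hx fun z ρ hρ => ?_
      have := h _ (mem_valueSet (x := x) hρ)
      simp only [inner_sub_right] at this ⊢
      linarith
    · have hd : DifferentiableAt ℝ (fun x' => f x' + inner ℝ a (c x')) x := by
        have h1 := hP.f_contDiff.differentiable one_ne_zero
        have h2 := hP.c_contDiff.differentiable one_ne_zero
        exact (h1 x).add ((differentiableAt_const a).inner ℝ (h2 x))
      have hloc : IsLocalMin (fun x' => f x' + inner ℝ a (c x')) x := by
        refine Eventually.of_forall fun x' => ?_
        have := h _ (mem_valueSet (x := x') hx.le)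
        simp only [inner_sub_right] at this ⊢
        linarith
      have := hd.hasFDerivAt
      rwa [hloc.fderiv_eq_zero] at this

omit [NormedAddCommGroup E] [InnerProductSpace ℝ E] in
/-- An `ε`-minimizer of the augmented Lagrangian, completed by the proximal step, is an
`ε`-minimizer of the regularized value function. -/
theorem exists_mem_valueSet_of_subproblem (hg : IsProper g) {μ ε : ℝ} (hμ : 0 < μ) {x : E}
    {z w : F} (hsub : augLagrangian f g c μ x w ≤ (⨅ x', augLagrangian f g c μ x' w) + (ε : EReal))
    (hprox : IsProx μ g (c x + μ • w) z) :
    ∃ r, (c x - z, r) ∈ valueSet f g c ∧ ∀ q ∈ valueSet f g c,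
      regValue μ w (c x - z, r) ≤ regValue μ w q + ε := by
  -- Completing the square: up to a constant, the proximal step minimizes over `z` inside the
  -- augmented Lagrangian.
  have hid : ∀ z' : F, 1 / (2 * μ) * ‖z' - (c x + μ • w)‖ ^ 2 =
      inner ℝ w (c x - z') + 1 / (2 * μ) * ‖c x - z'‖ ^ 2 + μ / 2 * ‖w‖ ^ 2 := fun z' => by
    have e : z' - (c x + μ • w) = -((c x - z') + μ • w) := by abel
    rw [e, norm_neg, norm_add_sq_real, inner_smul_right, norm_smul, mul_pow, Real.norm_eq_abs,
      sq_abs, real_inner_comm]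
    field_simp
    ring
  have hz : g z < ⊤ := by
    obtain ⟨z₀, hz₀⟩ := hg.1
    obtain ⟨ρ₀, hρ₀⟩ := hg.exists_coe hz₀
    have h1 := hprox z₀
    rw [hρ₀, ← EReal.coe_add] at h1
    refine lt_top_iff_ne_top.2 fun h => ?_
    rw [h, EReal.top_add_coe, top_le_iff] at h1
    exact EReal.coe_ne_top _ h1
  obtain ⟨ρ, hρ⟩ := hg.exists_coe hz
  refine ⟨f x + ρ, mem_valueSet hρ.le, ?_⟩
  have hlow : ((regValue μ w (c x - z, f x + ρ) : ℝ) : EReal) ≤ augLagrangian f g c μ x w := by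
    simp only [augLagrangian, coe_le_coe_add_iff, le_iInf_iff, coe_le_add_coe_iff, regValue]
    intro z' ρ' hρ'
    have h1 := (hprox z').trans (add_le_add_left hρ' _)
    rw [hρ, ← EReal.coe_add, ← EReal.coe_add, EReal.coe_le_coe_iff, hid, hid] at h1
    linarith
  rintro ⟨u, r⟩ ⟨x', ρ', hρ', rfl⟩
  have hup : augLagrangian f g c μ x' w ≤ ((regValue μ w (u, f x' + ρ') : ℝ) : EReal) := by
    rw [augLagrangian]
    refine (add_le_add_right ((iInf_le _ (c x' - u)).trans (add_le_add_left hρ' _)) _).trans ?_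
    rw [← EReal.coe_add, ← EReal.coe_add, EReal.coe_le_coe_iff, sub_sub_cancel, regValue]
    linarith
  have h2 := hlow.trans (hsub.trans (add_le_add_left ((iInf_le _ x').trans hup) _))
  rwa [← EReal.coe_add, EReal.coe_le_coe_iff] at h2

end Composite

end ConvexComposite

/-! ### Assembly of the convergence theorem -/

theorem theorem5p3 {E F : Type*}
    [NormedAddCommGroup E] [InnerProductSpace ℝ E] [FiniteDimensional ℝ E]
    [NormedAddCommGroup F] [InnerProductSpace ℝ F] [FiniteDimensional ℝ F]
    (f : E → ℝ) (g : F → EReal) (c : E → F)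
    (hP : ConvexComposite.FullyConvex f g c)
    (xbar : E)
    (hmin : ConvexComposite.IsMinimizer f g c xbar)
    (hstat : ConvexComposite.IsStationary f g c xbar)
    (Ysg : Set F) (β : ℝ)
    (x : ℕ → E) (z y yhat : ℕ → F) (μ ε : ℕ → ℝ)
    (halg : ConvexComposite.IsSafeguardedALM f g c Ysg β x z y yhat μ ε)
    (hsum : Summable fun k => Real.sqrt (ε k / μ k))
    (μlim : ℝ) (hμlim : 0 ≤ μlim)
    (hμ : Filter.Tendsto μ Filter.atTop (nhds μlim)) :
    Bornology.IsBounded (Set.range y) ∧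
    (μlim = 0 → ∀ a, MapClusterPt a Filter.atTop y →
      a ∈ ConvexComposite.multipliers f g c xbar) ∧
    (0 < μlim → ∃ a, ConvexComposite.SolvesPenalizedDual f g c Ysg μlim a ∧
      Filter.Tendsto y Filter.atTop (nhds a)) ∧
    ((ConvexComposite.multipliers f g c xbar ∩ Ysg).Nonempty →
      ∃ a ∈ ConvexComposite.multipliers f g c xbar ∩ Ysg,
        Filter.Tendsto y Filter.atTop (nhds a)) := by
  open ConvexComposite in
  obtain ⟨hdom, b, hgrad, hb⟩ := hstat
  obtain ⟨γ, hγ⟩ := hP.g_proper.exists_coe hdom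
  have hbm := hP.mem_multipliers_iff hγ |>.1
    ⟨mem_subdiff_of_mem_subdiff_conj hP.g_convex hP.g_lsc hγ hb, hgrad⟩
  have h0 : ((0 : F), f xbar + γ) ∈ valueSet f g c := by
    simpa using mem_valueSet (f := f) (c := c) (x := xbar) hγ.le
  have hA := hP.convex_valueSet
  have hμpos := pos_of_update halg.μ_zero_pos halg.μ_update
  have hcpt := halg.Ysg_compact
  have hstep : ∀ k, ∃ p, IsDualProx (valueSet f g c) (μ k) (yhat k) p ∧
      ‖y (k + 1) - p‖ ≤ Real.sqrt 2 * Real.sqrt (ε k / μ k) := fun k => by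
    obtain ⟨p, hp, hp'⟩ := exists_isDualProx hA ⟨_, h0⟩ ⟨_, hbm⟩ (hμpos k) (yhat k)
    obtain ⟨r, hr, hr'⟩ := exists_mem_valueSet_of_subproblem hP.g_proper (hμpos k)
      (halg.subproblem k) (halg.z_prox k)
    refine ⟨p, hp, ?_⟩
    rw [halg.y_update k]
    exact hp' _ hr _ hr'
  choose p hp hyp using hstep
  have he := hsum.mul_left (Real.sqrt 2)
  have hproj : ∀ k, yhat k ∈ Ysg := fun k => (halg.yhat_proj k).1
  have hconst : 0 < μlim → ∃ a, IsPenalizedSol (valueSet f g c) Ysg μlim a ∧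
      Filter.Tendsto y Filter.atTop (nhds a) := fun hpos => by
    -- Dropping the first `K` iterates makes the penalty parameter constant; convergence is
    -- unaffected.
    obtain ⟨K, hK⟩ := eventually_eq_of_update halg.β_mem.2 halg.μ_zero_pos halg.μ_update hpos hμ
    obtain ⟨a, ha, hlim⟩ := exists_tendsto_of_constant hA h0 ⟨_, hbm⟩ halg.Ysg_convex
      halg.Ysg_nonempty hcpt hpos ((summable_nat_add_iff K).2 he)
      (y := fun k => y (k + K)) (yhat := fun k => yhat (k + K)) (p := fun k => p (k + K))
      (fun k => halg.yhat_proj _) (fun k => hK k ▸ hp (k + K))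
      (fun k => by simpa only [add_right_comm] using hyp (k + K))
    exact ⟨a, ha, (Filter.tendsto_add_atTop_iff_nat K).1 hlim⟩
  refine ⟨isBounded_range_of_dualProx h0 hbm hcpt hμpos he hproj hp hyp, ?_, ?_, ?_⟩
  · rintro rfl a ha
    exact (hP.mem_multipliers_iff hγ).2
      (mem_dualHyp_of_mapClusterPt hbm hcpt hμpos hμ he hproj hp hyp ha)
  · intro hpos
    obtain ⟨a, ha, hlim⟩ := hconst hpos
    exact ⟨a, ha.solves h0, hlim⟩
  · rintro ⟨q, hqm, hqC⟩
    rw [hP.mem_multipliers_iff hγ] at hqm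
    rcases hμlim.eq_or_lt with rfl | hpos
    · obtain ⟨a, haC, ha, hlim⟩ := exists_tendsto_inter_of_tendsto_zero h0 halg.Ysg_convex hcpt
        hμpos hμ he halg.yhat_proj hp hyp ⟨q, hqC, hqm⟩
      exact ⟨a, ⟨(hP.mem_multipliers_iff hγ).2 ha, haC⟩, hlim⟩
    · obtain ⟨a, ha, hlim⟩ := hconst hpos
      have := ha.mem_inter h0 hcpt.isClosed hpos hqC hqm
      exact ⟨a, ⟨(hP.mem_multipliers_iff hγ).2 this.2, this.1⟩, hlim⟩
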